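/- A non-quasianalytic weight function is a continuous increasing (i.e. non-decreasing) function $\omega:[0,\infty)\to[0,\infty)$ such that: $(\alpha)$ there is $K\ge 1$ with $\omega(2t)\le K(1+\omega(t))$ for all $t\ge 0$; $(\beta)$ $\int_1^\infty \frac{\omega(t)}{1+t^2}\,dt<\infty$; $(\gamma)$ there are $a\in\mathbb R$, $b>0$ with $\omega(t)\ge a+b\log(1+t)$ for all $t\ge 0$; $(\delta)$ $\varphi_\omega(t)=\omega(e^t)$ is convex on $\mathbb R$. Put $\omega(x)=\omega(|x|)$ for $x\in\mathbb R^N$ and $\varphi_\omega^*(s)=\sup_{t\ge 0}\{st-\varphi_\omega(t)\}$ for $s\ge 0$ (this may be $+\infty$; we use $e^{-\infty}=0$ and $0\cdot\infty=0$). For $m\in\mathbb N=\{1,2,\dots\}$, $n\in\mathbb Z$ and $1\le p<\infty$ let $\mathcal O^m_{n,\omega}(\mathbb R^N)$, respectively $\mathcal O^m_{n,\omega,p}(\mathbb R^N)$, be the space of all $f\in C^\infty(\mathbb R^N)$ (complex-valued) for which $$r_{m,n}(f)=\sup_{\alpha\in\mathbb N_0^N}\sup_{x\in\mathbb R^N}|\partial^\alpha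 f(x)|\exp\Bigl(-n\omega(x)-m\varphi^*_\omega\bigl(\tfrac{|\alpha|}{m}\bigr)\Bigr)<\infty,$$ respectively $$r_{m,n,p}(f)=\Bigl(\sum_{\alpha\in\mathbb N_0^N}\|\exp(-n\omega)\,\partial^\alpha f\|_{L^p(\mathbb R^N)}^p\exp\Bigl(-mp\,\varphi^*_\omega\bigl(\tfrac{|\alpha|}{m}\bigr)\Bigr)\Bigr)^{1/p}<\infty,$$ endowed with the norm $r_{m,n}$, respectively $r_{m,n,p}$. Define $$\mathcal O_{M,\omega}(\mathbb R^N)=\bigcap_{m=1}^\infty\bigcup_{n=1}^\infty\mathcal O^m_{n,\omega}(\mathbb R^N),\qquad \mathcal O_{C,\omega}(\mathbb R^N)=\bigcup_{n=1}^\infty\bigcap_{m=1}^\infty\mathcal O^m_{n,\omega}(\mathbb R^N),$$ with the locally convex topologies $\operatorname{proj}_m\operatorname{ind}_n\mathcal O^m_{n,\omega}(\mathbb R^N)$ and $\operatorname{ind}_n\operatorname{proj}_m\mathcal O^m_{n,\omega}(\mathbb R^N)$, respectively, where $\operatorname{proj}$ denotes the projective limit topology and $\operatorname{ind}$ the locally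 convex inductive limit topology. Define $\mathcal O_{M,\omega,p}(\mathbb R^N)$ and $\mathcal O_{C,\omega,p}(\mathbb R^N)$ in the same way from the spaces $\mathcal O^m_{n,\omega,p}(\mathbb R^N)$. **Proposition.** Let $\omega$ be a non-quasianalytic weight function and $1\le p<\infty$. Then: 1. $\mathcal O_{M,\omega}(\mathbb R^N)=\mathcal O_{M,\omega,p}(\mathbb R^N)$ algebraically and topologically, that is, both sides consist of the same functions and carry the same topology. 2. $\mathcal O_{C,\omega}(\mathbb R^N)=\mathcal O_{C,\omega,p}(\mathbb R^N)$ algebraically and topologically. -/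

import Mathlib

open scoped ENNReal NNReal
open MeasureTheory

noncomputable section

namespace UltraDiff

/-! ### Weight functions -/

/-- A non-quasianalytic weight function `ω : [0, ∞) → [0, ∞)`. Only the values of `toFun` on
`[0, ∞)` are ever used. -/
structure Weight where
  toFun : ℝ → ℝ
  nonneg' : ∀ t, 0 ≤ t → 0 ≤ toFun t
  continuousOn' : ContinuousOn toFun (Set.Ici 0)
  monotoneOn' : MonotoneOn toFun (Set.Ici 0)
  /-- condition (α) -/
  doubling' : ∃ K : ℝ, 1 ≤ K ∧ ∀ t, 0 ≤ t → toFun (2 * t) ≤ K * (1 + toFun t)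
  /-- condition (β) -/
  integrable' : IntegrableOn (fun t : ℝ => toFun t / (1 + t ^ 2)) (Set.Ioi 1)
  /-- condition (γ) -/
  log_le' : ∃ a b : ℝ, 0 < b ∧ ∀ t, 0 ≤ t → a + b * Real.log (1 + t) ≤ toFun t
  /-- condition (δ) -/
  convex' : ConvexOn ℝ Set.univ (fun t : ℝ => toFun (Real.exp t))

instance : CoeFun Weight (fun _ => ℝ → ℝ) := ⟨Weight.toFun⟩

/-- The Young conjugate `φ*(s) = sup_{t ≥ 0} (s t - φ(t))` of `φ = ω ∘ exp`. It takes values in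
the extended reals, since the supremum may be `+∞` (as for `ω(t) = log (1 + t)`, `s > 1`). -/
def youngConj (ω : Weight) (s : ℝ) : EReal :=
  ⨆ t : {t : ℝ // 0 ≤ t}, ((s * t.1 - ω (Real.exp t.1) : ℝ) : EReal)

/-! ### Functions on `ℝ^N` and their partial derivatives -/

/-- The space `ℝ^N` with its Euclidean norm. -/
abbrev Eu (N : ℕ) : Type := EuclideanSpace ℝ (Fin N)

/-- The partial derivative `∂_i f`. -/
def pderiv {N : ℕ} (i : Fin N) (f : Eu N → ℂ) : Eu N → ℂ :=
  fun x => fderiv ℝ f x (EuclideanSpace.single i 1)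

/-- The partial derivative `∂^α f = ∂_0^{α_0} ⋯ ∂_{N-1}^{α_{N-1}} f` for a multi-index `α`. -/
def partialD {N : ℕ} (α : Fin N → ℕ) (f : Eu N → ℂ) : Eu N → ℂ :=
  (List.finRange N).foldr (fun i g => (pderiv i)^[α i] g) f

/-- The length `|α|` of a multi-index. -/
def mlen {N : ℕ} (α : Fin N → ℕ) : ℕ := ∑ i, α i

/-- The factor `exp (-m φ*(|α| / m))`, which is `0` if `φ*(|α| / m) = +∞`. -/
def derivWeight {N : ℕ} (ω : Weight) (m : ℕ+) (α : Fin N → ℕ) : ℝ≥0∞ :=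
  EReal.exp (-(((m : ℕ) : EReal) * youngConj ω ((mlen α : ℝ) / ((m : ℕ) : ℝ))))

/-- The function `exp (-n ω(|x|)) ∂^α f(x)`. -/
def weightedD {N : ℕ} (ω : Weight) (n : ℤ) (α : Fin N → ℕ) (f : Eu N → ℂ) : Eu N → ℂ :=
  fun x => (Real.exp (-((n : ℝ) * ω ‖x‖)) : ℂ) * partialD α f x

/-- The norm `r_{m,n}`, with values in `[0, ∞]`. -/
def supNorm {N : ℕ} (ω : Weight) (m : ℕ+) (n : ℤ) (f : Eu N → ℂ) : ℝ≥0∞ :=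
  ⨆ α : Fin N → ℕ, ⨆ x : Eu N, ‖weightedD ω n α f x‖ₑ * derivWeight ω m α

/-- The norm `r_{m,n,p}`, with values in `[0, ∞]`. -/
def lpNorm {N : ℕ} (ω : Weight) (p : ℝ≥0) (m : ℕ+) (n : ℤ) (f : Eu N → ℂ) : ℝ≥0∞ :=
  (∑' α : Fin N → ℕ,
    (eLpNorm (weightedD ω n α f) (p : ℝ≥0∞) volume * derivWeight ω m α) ^ (p : ℝ)) ^ (1 / (p : ℝ))

/-- The space `C^∞(ℝ^N)` of complex-valued smooth functions. -/
def smoothFun (N : ℕ) : Submodule ℂ (Eu N → ℂ) where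
  carrier := {f | ContDiff ℝ (⊤ : ℕ∞) f}
  add_mem' hf hg := ContDiff.add (Set.mem_ofPred.1 hf) (Set.mem_ofPred.1 hg)
  zero_mem' := Set.mem_ofPred.2 contDiff_const
  smul_mem' c _ hf := ContDiff.const_smul c (Set.mem_ofPred.1 hf)

/-! ### Function spaces with a topology, projective and inductive limits -/

/-- A linear subspace of the space of functions `ℝ^N → ℂ` together with a topology on it.
Two such objects are equal if and only if they consist of the same functions and carry the
same topology, i.e. if they agree algebraically and topologically. -/
structure FunSpace (N : ℕ) where
  carrier : Submodule ℂ (Eu N → ℂ)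
  topology : TopologicalSpace carrier

theorem FunSpace.eq_iff {N : ℕ} (A B : FunSpace N) :
    A = B ↔ ∃ h : A.carrier = B.carrier,
      A.topology = TopologicalSpace.induced (Submodule.inclusion h.le) B.topology := by
  constructor
  · rintro rfl
    exact ⟨rfl, (@induced_id _ A.topology).symm⟩
  · obtain ⟨S, s⟩ := A
    obtain ⟨T, t⟩ := B
    rintro ⟨h, h'⟩
    dsimp only at h
    subst h
    have h2 : s = t := h'.trans (@induced_id _ t)
    rw [h2]

/-- The normed space `{f ∈ C^∞ : r f < ∞}` with the topology of the norm `r`. -/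
def normedSpace {N : ℕ} (r : (Eu N → ℂ) → ℝ≥0∞) (h0 : r 0 = 0)
    (hadd : ∀ f ∈ smoothFun N, ∀ g ∈ smoothFun N, r (f + g) ≤ r f + r g)
    (hsmul : ∀ (c : ℂ), ∀ f ∈ smoothFun N, r (c • f) ≤ ‖c‖ₑ * r f) : FunSpace N :=
  let S : Submodule ℂ (Eu N → ℂ) :=
    { carrier := {f | f ∈ smoothFun N ∧ r f < ∞}
      add_mem' := fun hf hg => ⟨add_mem hf.1 hg.1,
        (hadd _ hf.1 _ hg.1).trans_lt (ENNReal.add_lt_top.2 ⟨hf.2, hg.2⟩)⟩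
      zero_mem' := ⟨zero_mem _, by simp [h0]⟩
      smul_mem' := fun c f hf => ⟨Submodule.smul_mem _ c hf.1,
        (hsmul c f hf.1).trans_lt (ENNReal.mul_lt_top enorm_lt_top hf.2)⟩ }
  let q : Seminorm ℂ S := Seminorm.ofSMulLE (fun f => (r f).toReal) (by simp [h0])
    (fun f g => by
      rw [← ENNReal.toReal_add f.2.2.ne g.2.2.ne]
      exact ENNReal.toReal_mono (ENNReal.add_ne_top.2 ⟨f.2.2.ne, g.2.2.ne⟩)
        (hadd _ f.2.1 _ g.2.1))
    (fun c f => by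
      have h := ENNReal.toReal_mono (ENNReal.mul_ne_top enorm_ne_top f.2.2.ne)
        (hsmul c _ f.2.1)
      simpa [ENNReal.toReal_mul] using h)
  ⟨S, q.toAddGroupSeminorm.toSeminormedAddCommGroup.toUniformSpace.toTopologicalSpace⟩

/-- The projective limit of a family of subspaces: the intersection, with the coarsest topology
making all inclusions `⋂ i, A i → A i` continuous. -/
def projLim {N : ℕ} {ι : Type} (A : ι → FunSpace N) : FunSpace N where
  carrier := ⨅ i, (A i).carrier
  topology := ⨅ i, TopologicalSpace.induced
    (Submodule.inclusion (iInf_le (fun j => (A j).carrier) i)) (A i).topology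

/-- The locally convex inductive limit of a family of subspaces: the sum of the subspaces (the
union if the family is directed), with the finest locally convex vector space topology making all
inclusions `A i → ∑ i, A i` continuous. -/
def indLim {N : ℕ} {ι : Type} (A : ι → FunSpace N) : FunSpace N where
  carrier := ⨆ i, (A i).carrier
  topology := sInf {t : TopologicalSpace ↥(⨆ i, (A i).carrier) |
    @IsTopologicalAddGroup _ t _ ∧ @ContinuousSMul ℂ _ _ _ t ∧
    @LocallyConvexSpace ℝ _ _ _ _ _ t ∧
    ∀ i, @Continuous _ _ (A i).topology t
      (Submodule.inclusion (le_iSup (fun j => (A j).carrier) i))}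

/-! ### The norm properties of `r_{m,n}` and `r_{m,n,p}` -/

theorem pderiv_add {N : ℕ} (i : Fin N) {f g : Eu N → ℂ} (hf : ContDiff ℝ (⊤ : ℕ∞) f)
    (hg : ContDiff ℝ (⊤ : ℕ∞) g) : pderiv i (f + g) = pderiv i f + pderiv i g := by
  funext x
  simp [pderiv, fderiv_add (hf.differentiable (by simp) x) (hg.differentiable (by simp) x)]

theorem pderiv_smul {N : ℕ} (i : Fin N) (c : ℂ) {f : Eu N → ℂ} (hf : ContDiff ℝ (⊤ : ℕ∞) f) :
    pderiv i (c • f) = c • pderiv i f := by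
  funext x
  simp [pderiv, fderiv_const_smul (hf.differentiable (by simp) x) c]

theorem contDiff_pderiv {N : ℕ} (i : Fin N) {f : Eu N → ℂ} (hf : ContDiff ℝ (⊤ : ℕ∞) f) :
    ContDiff ℝ (⊤ : ℕ∞) (pderiv i f) :=
  (hf.fderiv_right (by simp)).clm_apply contDiff_const

theorem contDiff_pderiv_iter {N : ℕ} (i : Fin N) (k : ℕ) {f : Eu N → ℂ}
    (hf : ContDiff ℝ (⊤ : ℕ∞) f) : ContDiff ℝ (⊤ : ℕ∞) ((pderiv i)^[k] f) := by
  induction k with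
  | zero => exact hf
  | succ k ih => rw [Function.iterate_succ_apply']; exact contDiff_pderiv i ih

theorem pderiv_iter_add {N : ℕ} (i : Fin N) (k : ℕ) {f g : Eu N → ℂ}
    (hf : ContDiff ℝ (⊤ : ℕ∞) f) (hg : ContDiff ℝ (⊤ : ℕ∞) g) :
    (pderiv i)^[k] (f + g) = (pderiv i)^[k] f + (pderiv i)^[k] g := by
  induction k with
  | zero => rfl
  | succ k ih =>
    simp only [Function.iterate_succ_apply', ih]
    exact pderiv_add i (contDiff_pderiv_iter i k hf) (contDiff_pderiv_iter i k hg)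

theorem pderiv_iter_smul {N : ℕ} (i : Fin N) (k : ℕ) (c : ℂ) {f : Eu N → ℂ}
    (hf : ContDiff ℝ (⊤ : ℕ∞) f) : (pderiv i)^[k] (c • f) = c • (pderiv i)^[k] f := by
  induction k with
  | zero => rfl
  | succ k ih =>
    simp only [Function.iterate_succ_apply', ih]
    exact pderiv_smul i c (contDiff_pderiv_iter i k hf)

theorem contDiff_partialD {N : ℕ} (α : Fin N → ℕ) {f : Eu N → ℂ} (hf : ContDiff ℝ (⊤ : ℕ∞) f) :
    ContDiff ℝ (⊤ : ℕ∞) (partialD α f) := by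
  unfold partialD
  induction List.finRange N with
  | nil => exact hf
  | cons i l ih => exact contDiff_pderiv_iter i _ ih

theorem partialD_add {N : ℕ} (α : Fin N → ℕ) {f g : Eu N → ℂ}
    (hf : ContDiff ℝ (⊤ : ℕ∞) f) (hg : ContDiff ℝ (⊤ : ℕ∞) g) :
    partialD α (f + g) = partialD α f + partialD α g := by
  have key : ∀ l : List (Fin N), ∀ f : Eu N → ℂ, ContDiff ℝ (⊤ : ℕ∞) f →
      ContDiff ℝ (⊤ : ℕ∞) (l.foldr (fun i g => (pderiv i)^[α i] g) f) := by
    intro l f hf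
    induction l with
    | nil => exact hf
    | cons i l ih => exact contDiff_pderiv_iter i _ ih
  unfold partialD
  induction List.finRange N with
  | nil => rfl
  | cons i l ih =>
    simp only [List.foldr_cons, ih]
    exact pderiv_iter_add i _ (key l f hf) (key l g hg)

theorem partialD_smul {N : ℕ} (α : Fin N → ℕ) (c : ℂ) {f : Eu N → ℂ}
    (hf : ContDiff ℝ (⊤ : ℕ∞) f) : partialD α (c • f) = c • partialD α f := by
  have key : ∀ l : List (Fin N),
      ContDiff ℝ (⊤ : ℕ∞) (l.foldr (fun i g => (pderiv i)^[α i] g) f) := by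
    intro l
    induction l with
    | nil => exact hf
    | cons i l ih => exact contDiff_pderiv_iter i _ ih
  unfold partialD
  induction List.finRange N with
  | nil => rfl
  | cons i l ih =>
    simp only [List.foldr_cons, ih]
    exact pderiv_iter_smul i _ c (key l)

theorem weightedD_add {N : ℕ} (ω : Weight) (n : ℤ) (α : Fin N → ℕ) {f g : Eu N → ℂ}
    (hf : ContDiff ℝ (⊤ : ℕ∞) f) (hg : ContDiff ℝ (⊤ : ℕ∞) g) :
    weightedD ω n α (f + g) = weightedD ω n α f + weightedD ω n α g := by
  funext x
  simp [weightedD, partialD_add α hf hg, mul_add]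

theorem weightedD_smul {N : ℕ} (ω : Weight) (n : ℤ) (α : Fin N → ℕ) (c : ℂ) {f : Eu N → ℂ}
    (hf : ContDiff ℝ (⊤ : ℕ∞) f) : weightedD ω n α (c • f) = c • weightedD ω n α f := by
  funext x
  simp [weightedD, partialD_smul α c hf, mul_left_comm]

theorem weightedD_zero {N : ℕ} (ω : Weight) (n : ℤ) (α : Fin N → ℕ) :
    weightedD ω n α (0 : Eu N → ℂ) = 0 := by
  have h := weightedD_smul ω n α 0 (f := (0 : Eu N → ℂ)) contDiff_const
  simpa using h

theorem continuous_weightedD {N : ℕ} (ω : Weight) (n : ℤ) (α : Fin N → ℕ) {f : Eu N → ℂ}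
    (hf : ContDiff ℝ (⊤ : ℕ∞) f) : Continuous (weightedD ω n α f) := by
  have h1 : Continuous fun x : Eu N => ω ‖x‖ :=
    ω.continuousOn'.comp_continuous continuous_norm (fun x => norm_nonneg x)
  exact (Complex.continuous_ofReal.comp
    (Real.continuous_exp.comp (continuous_const.mul h1).neg)).mul (contDiff_partialD α hf).continuous

theorem supNorm_zero {N : ℕ} (ω : Weight) (m : ℕ+) (n : ℤ) :
    supNorm ω m n (0 : Eu N → ℂ) = 0 := by
  simp [supNorm, weightedD_zero]

theorem supNorm_add {N : ℕ} (ω : Weight) (m : ℕ+) (n : ℤ) :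
    ∀ f ∈ smoothFun N, ∀ g ∈ smoothFun N,
      supNorm ω m n (f + g) ≤ supNorm ω m n f + supNorm ω m n g := by
  intro f hf g hg
  refine iSup_le fun α => iSup_le fun x => ?_
  rw [weightedD_add ω n α hf hg]
  refine (mul_le_mul_left (enorm_add_le _ _) _).trans ?_
  rw [add_mul]
  exact add_le_add
    (le_iSup₂_of_le (f := fun α x => ‖weightedD ω n α f x‖ₑ * derivWeight ω m α) α x le_rfl)
    (le_iSup₂_of_le (f := fun α x => ‖weightedD ω n α g x‖ₑ * derivWeight ω m α) α x le_rfl)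

theorem supNorm_smul {N : ℕ} (ω : Weight) (m : ℕ+) (n : ℤ) :
    ∀ c : ℂ, ∀ f ∈ smoothFun N, supNorm ω m n (c • f) ≤ ‖c‖ₑ * supNorm ω m n f := by
  intro c f hf
  refine iSup_le fun α => iSup_le fun x => ?_
  rw [weightedD_smul ω n α c hf, Pi.smul_apply, enorm_smul, mul_assoc]
  gcongr
  exact le_iSup₂_of_le (f := fun α x => ‖weightedD ω n α f x‖ₑ * derivWeight ω m α) α x le_rfl

theorem lpNorm_zero {N : ℕ} (ω : Weight) (p : ℝ≥0) (hp : 1 ≤ p) (m : ℕ+) (n : ℤ) :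
    lpNorm ω p m n (0 : Eu N → ℂ) = 0 := by
  have hp0 : (0 : ℝ) < p := by exact_mod_cast zero_lt_one.trans_le hp
  simp [lpNorm, weightedD_zero, hp0]

theorem tsum_Lp_add_le {ι : Type*} (a b : ι → ℝ≥0∞) {p : ℝ} (hp : 1 ≤ p) :
    (∑' i, (a i + b i) ^ p) ^ (1 / p) ≤ (∑' i, a i ^ p) ^ (1 / p) + (∑' i, b i ^ p) ^ (1 / p) := by
  have hp0 : 0 < p := zero_lt_one.trans_le hp
  rw [one_div, ENNReal.rpow_inv_le_iff hp0, ENNReal.tsum_eq_iSup_sum]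
  refine iSup_le fun s => ?_
  rw [← ENNReal.rpow_inv_le_iff hp0, ← one_div]
  refine (ENNReal.Lp_add_le s a b hp).trans ?_
  gcongr <;> exact ENNReal.sum_le_tsum s

theorem lpNorm_add {N : ℕ} (ω : Weight) (p : ℝ≥0) (hp : 1 ≤ p) (m : ℕ+) (n : ℤ) :
    ∀ f ∈ smoothFun N, ∀ g ∈ smoothFun N,
      lpNorm ω p m n (f + g) ≤ lpNorm ω p m n f + lpNorm ω p m n g := by
  intro f hf g hg
  refine le_trans ?_ (tsum_Lp_add_le _ _ (by exact_mod_cast hp))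
  unfold lpNorm
  gcongr with α
  rw [weightedD_add ω n α hf hg, ← add_mul]
  gcongr
  exact eLpNorm_add_le (continuous_weightedD ω n α hf).aestronglyMeasurable
    (continuous_weightedD ω n α hg).aestronglyMeasurable (by exact_mod_cast hp)

theorem lpNorm_smul {N : ℕ} (ω : Weight) (p : ℝ≥0) (hp : 1 ≤ p) (m : ℕ+) (n : ℤ) :
    ∀ c : ℂ, ∀ f ∈ smoothFun N, lpNorm ω p m n (c • f) ≤ ‖c‖ₑ * lpNorm ω p m n f := by
  intro c f hf
  have hp0 : (0 : ℝ) < p := by exact_mod_cast zero_lt_one.trans_le hp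
  unfold lpNorm
  simp_rw [weightedD_smul ω n _ c hf, eLpNorm_const_smul, mul_assoc,
    ENNReal.mul_rpow_of_nonneg ‖c‖ₑ _ hp0.le]
  rw [ENNReal.tsum_mul_left, ENNReal.mul_rpow_of_nonneg _ _ (by positivity), one_div,
    ENNReal.rpow_rpow_inv hp0.ne']

/-! ### The spaces of slowly and very slowly increasing functions -/

/-- The space `O^m_{n,ω}(ℝ^N)`, normed by `r_{m,n}`. -/
def Omn (N : ℕ) (ω : Weight) (m : ℕ+) (n : ℤ) : FunSpace N :=
  normedSpace (supNorm ω m n) (supNorm_zero ω m n) (supNorm_add ω m n) (supNorm_smul ω m n)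

/-- The space `O^m_{n,ω,p}(ℝ^N)`, normed by `r_{m,n,p}`. -/
def OmnLp (N : ℕ) (ω : Weight) (p : ℝ≥0) (hp : 1 ≤ p) (m : ℕ+) (n : ℤ) : FunSpace N :=
  normedSpace (lpNorm ω p m n) (lpNorm_zero ω p hp m n) (lpNorm_add ω p hp m n)
    (lpNorm_smul ω p hp m n)

/-- `O_{M,ω}(ℝ^N) = proj_m ind_n O^m_{n,ω}(ℝ^N)`. -/
def OM (N : ℕ) (ω : Weight) : FunSpace N :=
  projLim fun m : ℕ+ => indLim fun n : ℕ+ => Omn N ω m ((n : ℕ) : ℤ)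

/-- `O_{C,ω}(ℝ^N) = ind_n proj_m O^m_{n,ω}(ℝ^N)`. -/
def OC (N : ℕ) (ω : Weight) : FunSpace N :=
  indLim fun n : ℕ+ => projLim fun m : ℕ+ => Omn N ω m ((n : ℕ) : ℤ)

/-- `O_{M,ω,p}(ℝ^N) = proj_m ind_n O^m_{n,ω,p}(ℝ^N)`. -/
def OMLp (N : ℕ) (ω : Weight) (p : ℝ≥0) (hp : 1 ≤ p) : FunSpace N :=
  projLim fun m : ℕ+ => indLim fun n : ℕ+ => OmnLp N ω p hp m ((n : ℕ) : ℤ)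

/-- `O_{C,ω,p}(ℝ^N) = ind_n proj_m O^m_{n,ω,p}(ℝ^N)`. -/
def OCLp (N : ℕ) (ω : Weight) (p : ℝ≥0) (hp : 1 ≤ p) : FunSpace N :=
  indLim fun n : ℕ+ => projLim fun m : ℕ+ => OmnLp N ω p hp m ((n : ℕ) : ℤ)

/-! ### The underlying sets of these spaces -/

theorem norm_weightedD_anti {N : ℕ} (ω : Weight) {n n' : ℤ} (h : n ≤ n') (α : Fin N → ℕ)
    (f : Eu N → ℂ) (x : Eu N) : ‖weightedD ω n' α f x‖ ≤ ‖weightedD ω n α f x‖ := by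
  have h0 := ω.nonneg' ‖x‖ (norm_nonneg x)
  have h1 : (n : ℝ) ≤ n' := by exact_mod_cast h
  simp only [weightedD, norm_mul, Complex.norm_real, Real.norm_eq_abs, Real.abs_exp]
  gcongr

theorem supNorm_anti {N : ℕ} (ω : Weight) (m : ℕ+) {n n' : ℤ} (h : n ≤ n') (f : Eu N → ℂ) :
    supNorm ω m n' f ≤ supNorm ω m n f := by
  refine iSup_mono fun α => iSup_mono fun x => ?_
  gcongr
  exact enorm_le_iff_norm_le.2 (norm_weightedD_anti ω h α f x)

theorem lpNorm_anti {N : ℕ} (ω : Weight) (p : ℝ≥0) (m : ℕ+) {n n' : ℤ} (h : n ≤ n')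
    (f : Eu N → ℂ) : lpNorm ω p m n' f ≤ lpNorm ω p m n f := by
  unfold lpNorm
  gcongr with α
  exact eLpNorm_mono fun x => norm_weightedD_anti ω h α f x

theorem mem_indLim {N : ℕ} (A : ℕ+ → FunSpace N)
    (hA : ∀ n n', n ≤ n' → (A n).carrier ≤ (A n').carrier) (f : Eu N → ℂ) :
    f ∈ (indLim A).carrier ↔ ∃ n, f ∈ (A n).carrier :=
  Submodule.mem_iSup_of_directed _ (Monotone.directed_le fun n n' h => hA n n' h)

theorem mem_projLim {N : ℕ} {ι : Type} (A : ι → FunSpace N) (f : Eu N → ℂ) :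
    f ∈ (projLim A).carrier ↔ ∀ i, f ∈ (A i).carrier :=
  Submodule.mem_iInf _

theorem mem_Omn {N : ℕ} (ω : Weight) (m : ℕ+) (n : ℤ) (f : Eu N → ℂ) :
    f ∈ (Omn N ω m n).carrier ↔ ContDiff ℝ (⊤ : ℕ∞) f ∧ supNorm ω m n f < ∞ :=
  Iff.rfl

theorem mem_OmnLp {N : ℕ} (ω : Weight) (p : ℝ≥0) (hp : 1 ≤ p) (m : ℕ+) (n : ℤ)
    (f : Eu N → ℂ) :
    f ∈ (OmnLp N ω p hp m n).carrier ↔ ContDiff ℝ (⊤ : ℕ∞) f ∧ lpNorm ω p m n f < ∞ :=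
  Iff.rfl

theorem Omn_mono {N : ℕ} (ω : Weight) (m : ℕ+) {n n' : ℤ} (h : n ≤ n') :
    (Omn N ω m n).carrier ≤ (Omn N ω m n').carrier :=
  fun f hf => ⟨hf.1, (supNorm_anti ω m h f).trans_lt hf.2⟩

theorem OmnLp_mono {N : ℕ} (ω : Weight) (p : ℝ≥0) (hp : 1 ≤ p) (m : ℕ+) {n n' : ℤ}
    (h : n ≤ n') : (OmnLp N ω p hp m n).carrier ≤ (OmnLp N ω p hp m n').carrier :=
  fun f hf => ⟨hf.1, (lpNorm_anti ω p m h f).trans_lt hf.2⟩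

theorem pnat_cast_le {n n' : ℕ+} (h : n ≤ n') : ((n : ℕ) : ℤ) ≤ ((n' : ℕ) : ℤ) := by
  exact_mod_cast h

theorem mem_OM {N : ℕ} (ω : Weight) (f : Eu N → ℂ) :
    f ∈ (OM N ω).carrier ↔ ∀ m : ℕ+, ∃ n : ℕ+, f ∈ (Omn N ω m ((n : ℕ) : ℤ)).carrier :=
  (mem_projLim _ f).trans (forall_congr' fun m =>
    mem_indLim _ (fun _ _ h => Omn_mono ω m (pnat_cast_le h)) f)

theorem mem_OMLp {N : ℕ} (ω : Weight) (p : ℝ≥0) (hp : 1 ≤ p) (f : Eu N → ℂ) :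
    f ∈ (OMLp N ω p hp).carrier ↔
      ∀ m : ℕ+, ∃ n : ℕ+, f ∈ (OmnLp N ω p hp m ((n : ℕ) : ℤ)).carrier :=
  (mem_projLim _ f).trans (forall_congr' fun m =>
    mem_indLim _ (fun _ _ h => OmnLp_mono ω p hp m (pnat_cast_le h)) f)

theorem mem_OC {N : ℕ} (ω : Weight) (f : Eu N → ℂ) :
    f ∈ (OC N ω).carrier ↔ ∃ n : ℕ+, ∀ m : ℕ+, f ∈ (Omn N ω m ((n : ℕ) : ℤ)).carrier :=
  (mem_indLim _ (fun _ _ h => iInf_mono fun m => Omn_mono ω m (pnat_cast_le h)) f).trans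
    (exists_congr fun _ => mem_projLim _ f)

theorem mem_OCLp {N : ℕ} (ω : Weight) (p : ℝ≥0) (hp : 1 ≤ p) (f : Eu N → ℂ) :
    f ∈ (OCLp N ω p hp).carrier ↔
      ∃ n : ℕ+, ∀ m : ℕ+, f ∈ (OmnLp N ω p hp m ((n : ℕ) : ℤ)).carrier :=
  (mem_indLim _ (fun _ _ h => iInf_mono fun m => OmnLp_mono ω p hp m (pnat_cast_le h)) f).trans
    (exists_congr fun _ => mem_projLim _ f)

end UltraDiff

end

open scoped ENNReal NNReal
open MeasureTheory

noncomputable section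

namespace UltraDiff

/-! ### Continuous inclusions between function spaces -/

/-! Everything reduces to two estimates between single norms, each allowed to worsen the indices:
`exists_lpNorm_le_supNorm` and `exists_supNorm_le_lpNorm`. Both exploit that the factor `exp (-m
φ*(|α|/m))` is the infimum over `t ≥ 0` of `exp (m ω(e^t) - |α| t)`.

Sup to `L^p`: by (γ), `exp (-kω)` lies in `L^p` for large `k`, so raising `n` by `k` gives
integrability in `x`. By (α), shifting `t` by `log 2` gains a factor `2^(-|α|)` at the cost of a
larger `m`, which makes the sum over `α` converge.

`L^p` to sup: a Sobolev inequality on the unit cube at `x` bounds `|∂^α f(x)|` by integrals of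
derivatives with at most one extra derivative per variable. By (α), `ω` on the cube is at most `K
ω(x) + c`, so `n` is multiplied by `K`; the at most `N` extra derivatives are absorbed into a larger
`m` by (γ).

In both estimates the new `n` does not depend on `m`, nor the new `m` on `n`. This uniformity lets
the same inclusions of steps serve `proj ind` and `ind proj`; the universal properties of the limits
and antisymmetry then give equality of the topologies. -/

/-- `A` is contained in `B` with continuous inclusion. -/
def ContIncl {N : ℕ} (A B : FunSpace N) : Prop :=
  ∃ h : A.carrier ≤ B.carrier, @Continuous _ _ A.topology B.topology (Submodule.inclusion h)

theorem ContIncl.antisymm {N : ℕ} {A B : FunSpace N} (h : ContIncl A B) (h' : ContIncl B A) :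
    A = B := by
  obtain ⟨S, s⟩ := A
  obtain ⟨T, t⟩ := B
  obtain ⟨h1, h2⟩ := h
  obtain ⟨h3, h4⟩ := h'
  dsimp only at h1 h3 h2 h4
  obtain rfl : S = T := le_antisymm h1 h3
  have : s = t := le_antisymm (continuous_id_iff_le.1 h2) (continuous_id_iff_le.1 h4)
  rw [this]

theorem ContIncl.trans {N : ℕ} {A B C : FunSpace N} (h : ContIncl A B) (h' : ContIncl B C) :
    ContIncl A C := by
  obtain ⟨h1, h2⟩ := h
  obtain ⟨h3, h4⟩ := h'
  exact ⟨h1.trans h3, @Continuous.comp _ _ _ A.topology B.topology C.topology _ _ h4 h2⟩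

theorem projLim_contIncl {N : ℕ} {ι : Type} (A : ι → FunSpace N) (i : ι) :
    ContIncl (projLim A) (A i) :=
  ⟨iInf_le (fun j => (A j).carrier) i, continuous_iff_le_induced.2 (iInf_le _ i)⟩

theorem contIncl_projLim {N : ℕ} {ι : Type} {A : ι → FunSpace N} {B : FunSpace N}
    (h : ∀ i, ContIncl B (A i)) : ContIncl B (projLim A) :=
  ⟨le_iInf fun i => (h i).1, continuous_iInf_rng.2 fun i => continuous_induced_rng.2 (h i).2⟩

theorem contIncl_indLim {N : ℕ} {ι : Type} (A : ι → FunSpace N) (i : ι) :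
    ContIncl (A i) (indLim A) :=
  ⟨le_iSup (fun j => (A j).carrier) i, continuous_sInf_rng.2 fun _ ht => ht.2.2.2 i⟩

/-- The topology of `A` is a locally convex vector space topology. -/
def IsLC {N : ℕ} (A : FunSpace N) : Prop :=
  @IsTopologicalAddGroup _ A.topology _ ∧ @ContinuousSMul ℂ _ _ _ A.topology ∧
    @LocallyConvexSpace ℝ _ _ _ _ _ A.topology

theorem isLC_induced {N : ℕ} {B : FunSpace N} (hB : IsLC B) {S : Submodule ℂ (Eu N → ℂ)}
    (h : S ≤ B.carrier) :
    IsLC ⟨S, TopologicalSpace.induced (Submodule.inclusion h) B.topology⟩ := by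
  let := B.topology
  obtain ⟨h1, h2, h3⟩ := hB
  exact ⟨topologicalAddGroup_induced _, continuousSMul_induced (Submodule.inclusion h),
    LocallyConvexSpace.induced ((Submodule.inclusion h).restrictScalars ℝ)⟩

/-- The topology pulled back from `B` is itself one of the locally convex topologies over which the
infimum defining `indLim` is taken, so the inductive topology is finer than it. -/
theorem indLim_contIncl {N : ℕ} {ι : Type} {A : ι → FunSpace N} {B : FunSpace N} (hB : IsLC B)
    (h : ∀ i, ContIncl (A i) B) : ContIncl (indLim A) B := by
  have hle : (⨆ i, (A i).carrier) ≤ B.carrier := iSup_le fun i => (h i).1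
  have hLC := isLC_induced hB hle
  exact ⟨hle, continuous_iff_le_induced.2 <| sInf_le
    ⟨hLC.1, hLC.2.1, hLC.2.2, fun i => continuous_induced_rng.2 (h i).2⟩⟩

/-- An infimum of topologies is their common refinement, and locally convex vector topologies are
stable under it. This makes an inductive limit an admissible target in `indLim_contIncl`. -/
theorem isLC_indLim {N : ℕ} {ι : Type} (A : ι → FunSpace N) : IsLC (indLim A) :=
  ⟨topologicalAddGroup_sInf fun _ ht => ht.1, continuousSMul_sInf fun _ ht => ht.2.1,
    LocallyConvexSpace.sInf fun _ ht => ht.2.2.1⟩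

section normedSpace

variable {N : ℕ} {r r' : (Eu N → ℂ) → ℝ≥0∞} {h0 : r 0 = 0} {h0' : r' 0 = 0}
  {hadd : ∀ f ∈ smoothFun N, ∀ g ∈ smoothFun N, r (f + g) ≤ r f + r g}
  {hadd' : ∀ f ∈ smoothFun N, ∀ g ∈ smoothFun N, r' (f + g) ≤ r' f + r' g}
  {hsmul : ∀ (c : ℂ), ∀ f ∈ smoothFun N, r (c • f) ≤ ‖c‖ₑ * r f}
  {hsmul' : ∀ (c : ℂ), ∀ f ∈ smoothFun N, r' (c • f) ≤ ‖c‖ₑ * r' f}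

/-- The seminorm defining the topology of `normedSpace`. -/
def normedSpaceSeminorm (h0 : r 0 = 0)
    (hadd : ∀ f ∈ smoothFun N, ∀ g ∈ smoothFun N, r (f + g) ≤ r f + r g)
    (hsmul : ∀ (c : ℂ), ∀ f ∈ smoothFun N, r (c • f) ≤ ‖c‖ₑ * r f) :
    Seminorm ℂ (normedSpace r h0 hadd hsmul).carrier :=
  Seminorm.ofSMulLE (fun f => (r f).toReal) (by simp [h0])
    (fun f g => by
      rw [← ENNReal.toReal_add f.2.2.ne g.2.2.ne]
      exact ENNReal.toReal_mono (ENNReal.add_ne_top.2 ⟨f.2.2.ne, g.2.2.ne⟩)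
        (hadd _ f.2.1 _ g.2.1))
    (fun c f => by
      have h := ENNReal.toReal_mono (ENNReal.mul_ne_top enorm_ne_top f.2.2.ne)
        (hsmul c _ f.2.1)
      simpa [ENNReal.toReal_mul] using h)

theorem normedSpace_contIncl
    (h : ∃ C : ℝ≥0∞, C ≠ ∞ ∧ ∀ f ∈ smoothFun N, r' f ≤ C * r f) :
    ContIncl (normedSpace r h0 hadd hsmul) (normedSpace r' h0' hadd' hsmul') := by
  obtain ⟨C, hC, h⟩ := h
  have hle : (normedSpace r h0 hadd hsmul).carrier ≤ (normedSpace r' h0' hadd' hsmul').carrier :=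
    fun f hf => ⟨hf.1, (h f hf.1).trans_lt (ENNReal.mul_lt_top hC.lt_top hf.2)⟩
  refine ⟨hle, ?_⟩
  -- These instances induce, by definition, the topologies carried by the two `normedSpace`s.
  let : SeminormedAddCommGroup (normedSpace r h0 hadd hsmul).carrier :=
    (normedSpaceSeminorm h0 hadd hsmul).toAddGroupSeminorm.toSeminormedAddCommGroup
  let : SeminormedAddCommGroup (normedSpace r' h0' hadd' hsmul').carrier :=
    (normedSpaceSeminorm h0' hadd' hsmul').toAddGroupSeminorm.toSeminormedAddCommGroup
  refine AddMonoidHomClass.continuous_of_bound (Submodule.inclusion hle) C.toReal fun f => ?_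
  change (r' f).toReal ≤ C.toReal * (r f).toReal
  rw [← ENNReal.toReal_mul]
  exact ENNReal.toReal_mono (ENNReal.mul_ne_top hC f.2.2.ne) (h f f.2.1)

end normedSpace

/-! ### The weights `exp (-m φ*(|α| / m))` -/

/-- `exp` and `x ↦ x^m` are order isomorphisms and inversion reverses order, so the supremum in `φ*`
passes through as an infimum; an infinite `φ*` needs no separate case. -/
theorem derivWeight_eq_iInf {N : ℕ} (ω : Weight) (m : ℕ+) (α : Fin N → ℕ) :
    derivWeight ω m α = ⨅ t : {t : ℝ // 0 ≤ t},
      ENNReal.ofReal (Real.exp (m * ω (Real.exp t.1) - mlen α * t.1)) := by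
  have hm : (0 : ℝ) < (m : ℕ) := by exact_mod_cast m.pos
  have h1 : EReal.exp (youngConj ω ((mlen α : ℝ) / ((m : ℕ) : ℝ))) = ⨆ t : {t : ℝ // 0 ≤ t},
      ENNReal.ofReal (Real.exp ((mlen α : ℝ) / ((m : ℕ) : ℝ) * t.1 - ω (Real.exp t.1))) :=
    EReal.expOrderIso.map_iSup _
  have h2 := (ENNReal.orderIsoRpow ((m : ℕ) : ℝ) hm).map_iSup fun t : {t : ℝ // 0 ≤ t} =>
    ENNReal.ofReal (Real.exp ((mlen α : ℝ) / ((m : ℕ) : ℝ) * t.1 - ω (Real.exp t.1)))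
  simp only [ENNReal.orderIsoRpow_apply] at h2
  rw [derivWeight, EReal.exp_neg, EReal.exp_nmul, h1, ← ENNReal.rpow_natCast, h2, ENNReal.inv_iSup]
  congr 1 with t
  rw [ENNReal.ofReal_rpow_of_pos (Real.exp_pos _), ← Real.exp_mul,
    ← ENNReal.ofReal_inv_of_pos (Real.exp_pos _), ← Real.exp_neg]
  congr 2
  field_simp
  ring

theorem derivWeight_le {N : ℕ} (ω : Weight) (m : ℕ+) (α : Fin N → ℕ) {t : ℝ} (ht : 0 ≤ t) :
    derivWeight ω m α ≤ ENNReal.ofReal (Real.exp (m * ω (Real.exp t) - mlen α * t)) := by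
  rw [derivWeight_eq_iInf]
  exact iInf_le _ (⟨t, ht⟩ : {t : ℝ // 0 ≤ t})

theorem derivWeight_ne_top {N : ℕ} (ω : Weight) (m : ℕ+) (α : Fin N → ℕ) :
    derivWeight ω m α ≠ ∞ :=
  ((derivWeight_le ω m α le_rfl).trans_lt ENNReal.ofReal_lt_top).ne

/-- Evaluate the left infimum at `t + log 2`: the linear term yields `2^(-|α|)`, and `m ω(2e^t) ≤ mK
+ mK ω(e^t)` by (α), so any `m' ≥ mK` works. -/
theorem exists_derivWeight_le_geometric {N : ℕ} (ω : Weight) (m : ℕ+) :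
    ∃ m' : ℕ+, ∃ C : ℝ≥0∞, C ≠ ∞ ∧ ∀ α : Fin N → ℕ,
      derivWeight ω m α ≤ C * 2⁻¹ ^ mlen α * derivWeight ω m' α := by
  obtain ⟨K, hK, hdbl⟩ := ω.doubling'
  obtain ⟨k, hk⟩ := exists_nat_ge (m * K)
  have hm : (1 : ℝ) ≤ m := by exact_mod_cast m.pos
  have hk0 : 0 < k := by
    have : (0 : ℝ) < k := by nlinarith
    exact_mod_cast this
  refine ⟨⟨k, hk0⟩, ENNReal.ofReal (Real.exp (m * K)), ENNReal.ofReal_ne_top, fun α => ?_⟩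
  have h2 : (2⁻¹ : ℝ≥0∞) ^ mlen α = ENNReal.ofReal (Real.exp (-(mlen α * Real.log 2))) := by
    rw [← mul_neg, Real.exp_nat_mul, Real.exp_neg, Real.exp_log two_pos,
      ENNReal.ofReal_pow (by positivity), ENNReal.ofReal_inv_of_pos two_pos]
    simp
  rw [h2, ← ENNReal.ofReal_mul (Real.exp_nonneg _), ← Real.exp_add, derivWeight_eq_iInf ω ⟨k, hk0⟩,
    ENNReal.mul_iInf_of_ne (by positivity) ENNReal.ofReal_ne_top]
  refine le_iInf fun t => ?_
  have hlog := Real.log_nonneg one_le_two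
  refine (derivWeight_le ω m α (add_nonneg t.2 hlog)).trans ?_
  rw [← ENNReal.ofReal_mul (Real.exp_nonneg _), ← Real.exp_add]
  refine ENNReal.ofReal_le_ofReal (Real.exp_le_exp.2 ?_)
  have h3 : ω (Real.exp (t.1 + Real.log 2)) ≤ K * (1 + ω (Real.exp t.1)) := by
    rw [Real.exp_add, Real.exp_log two_pos, mul_comm]
    exact hdbl _ (Real.exp_nonneg _)
  have h4 := ω.nonneg' _ (Real.exp_nonneg t.1)
  have h5 := mul_le_mul_of_nonneg_left h3 (zero_le_one.trans hm)
  have h6 := mul_le_mul_of_nonneg_right hk h4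
  simp only [PNat.mk_coe]
  nlinarith

/-- With `k b ≥ d`, condition (γ) gives `|β| t ≤ k b t ≤ k (ω(e^t) - a)`: raising `m` by `k` pays
for up to `d` further derivatives. -/
theorem exists_derivWeight_le_add {N : ℕ} (ω : Weight) (m : ℕ+) (d : ℕ) :
    ∃ m' : ℕ+, ∃ C : ℝ≥0∞, C ≠ ∞ ∧ ∀ α β : Fin N → ℕ, mlen β ≤ d →
      derivWeight ω m α ≤ C * derivWeight ω m' (α + β) := by
  obtain ⟨a, b, hb, hlog⟩ := ω.log_le'
  obtain ⟨k, hk⟩ := exists_nat_ge (d / b)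
  rw [div_le_iff₀ hb] at hk
  refine ⟨⟨m + k, by positivity⟩, ENNReal.ofReal (Real.exp (-(k * a))), ENNReal.ofReal_ne_top,
    fun α β hβ => ?_⟩
  rw [derivWeight_eq_iInf ω ⟨m + k, _⟩,
    ENNReal.mul_iInf_of_ne (by positivity) ENNReal.ofReal_ne_top]
  refine le_iInf fun t => (derivWeight_le ω m α t.2).trans ?_
  rw [← ENNReal.ofReal_mul (Real.exp_nonneg _), ← Real.exp_add]
  refine ENNReal.ofReal_le_ofReal (Real.exp_le_exp.2 ?_)
  have h1 : a + b * t.1 ≤ ω (Real.exp t.1) := by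
    refine le_trans ?_ (hlog _ (Real.exp_nonneg _))
    have : t.1 ≤ Real.log (1 + Real.exp t.1) := by
      rw [Real.le_log_iff_exp_le (by positivity)]
      linarith
    gcongr
  have h2 : (mlen (α + β) : ℝ) = mlen α + mlen β := by
    simp [mlen, Finset.sum_add_distrib]
  have h3 : (mlen β : ℝ) * t.1 ≤ k * b * t.1 :=
    mul_le_mul_of_nonneg_right (le_trans (by exact_mod_cast hβ) hk) t.2
  have h4 := mul_le_mul_of_nonneg_left h1 (Nat.cast_nonneg (α := ℝ) k)
  simp only [PNat.mk_coe, h2, Nat.cast_add]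
  nlinarith

theorem tsum_geometric_mlen_ne_top (N : ℕ) :
    ∑' α : Fin N → ℕ, (2⁻¹ : ℝ≥0∞) ^ mlen α ≠ ∞ := by
  induction N with
  | zero => simp [mlen]
  | succ N ih =>
    rw [← (Fin.consEquiv fun _ : Fin (N + 1) => ℕ).tsum_eq, ENNReal.tsum_prod']
    have : ∀ (a : ℕ) (β : Fin N → ℕ), (2⁻¹ : ℝ≥0∞) ^
        mlen ((Fin.consEquiv fun _ : Fin (N + 1) => ℕ) (a, β)) = 2⁻¹ ^ a * 2⁻¹ ^ mlen β := by
      intro a β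
      simp [mlen, Fin.consEquiv, Fin.sum_univ_succ, pow_add]
    simp_rw [this, ENNReal.tsum_mul_left, ENNReal.tsum_mul_right]
    exact ENNReal.mul_ne_top (by simp [ENNReal.tsum_geometric]) ih

/-! ### Estimate of the `L^p` norms by the supremum norms -/

/-- By (γ), `exp (-kω)` is dominated by a multiple of `(1 + |x|)^(-kb)`, whose `p`-th power is
integrable once `k b > N`, as `p ≥ 1`. -/
theorem exists_eLpNorm_exp_weight_ne_top (N : ℕ) (ω : Weight) {p : ℝ≥0} (hp : 1 ≤ p) :
    ∃ k : ℕ, eLpNorm (fun x : Eu N => Real.exp (-(k * ω ‖x‖))) p volume ≠ ∞ := by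
  obtain ⟨a, b, hb, hlog⟩ := ω.log_le'
  obtain ⟨k, hk⟩ := exists_nat_gt (N / b)
  rw [div_lt_iff₀ hb] at hk
  have hp' : (1 : ℝ) ≤ p := by exact_mod_cast hp
  refine ⟨k, ne_top_of_le_ne_top ?_ (eLpNorm_mono_enorm (g := fun x : Eu N =>
    Real.exp (-(k * a)) • (1 + ‖x‖) ^ (-(k * b))) fun x => ?_)⟩
  · rw [show (fun x : Eu N => Real.exp (-(k * a)) • (1 + ‖x‖) ^ (-(k * b))) =
      Real.exp (-(k * a)) • fun x : Eu N => (1 + ‖x‖) ^ (-(k * b)) from rfl, eLpNorm_const_smul]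
    refine ENNReal.mul_ne_top enorm_ne_top (ne_of_lt ?_)
    rw [eLpNorm_lt_top_iff_lintegral_rpow_enorm_lt_top
      (by exact_mod_cast (zero_lt_one.trans_le hp).ne') (by simp)]
    have hint := finite_integral_one_add_norm (E := Eu N) (μ := volume) (r := k * b * p)
      (by simp; nlinarith)
    convert hint using 3 with x
    have h1 : 0 < 1 + ‖x‖ := by positivity
    rw [Real.enorm_of_nonneg (by positivity), ENNReal.coe_toReal,
      ENNReal.ofReal_rpow_of_nonneg (by positivity) (by positivity), ← Real.rpow_mul h1.le, neg_mul]
  · rw [enorm_le_iff_norm_le]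
    have h1 : 0 < 1 + ‖x‖ := by positivity
    rw [Real.norm_of_nonneg (by positivity), Real.norm_of_nonneg (by positivity), smul_eq_mul,
      Real.rpow_def_of_pos h1, ← Real.exp_add]
    have := mul_le_mul_of_nonneg_left (hlog ‖x‖ (norm_nonneg x)) (Nat.cast_nonneg (α := ℝ) k)
    exact Real.exp_le_exp.2 (by linarith)

theorem enorm_weightedD_add_left {N : ℕ} (ω : Weight) (n : ℤ) (k : ℕ) (α : Fin N → ℕ)
    (f : Eu N → ℂ) (x : Eu N) :
    ‖weightedD ω (n + k) α f x‖ₑ = ‖Real.exp (-(k * ω ‖x‖))‖ₑ * ‖weightedD ω n α f x‖ₑ := by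
  have : (Real.exp (-(((n + k : ℤ) : ℝ) * ω ‖x‖)) : ℂ) =
      (Real.exp (-(k * ω ‖x‖)) : ℂ) * (Real.exp (-(n * ω ‖x‖)) : ℂ) := by
    rw [← Complex.ofReal_mul, ← Real.exp_add]
    congr 2
    push_cast
    ring
  rw [weightedD, this, mul_assoc, enorm_mul]
  congr 1
  exact enorm_eq_iff_norm_eq.2 (Complex.norm_real _)

theorem eLpNorm_mul_le_of_enorm_mul_le {X E F : Type*} [MeasurableSpace X] {μ : Measure X}
    [NormedAddCommGroup E] [NormedSpace ℝ E] [NormedAddCommGroup F] [NormedSpace ℝ F]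
    {p : ℝ≥0∞} {f : X → E} {g : X → F} {a b : ℝ≥0∞} (ha : a ≠ ∞) (hb : b ≠ ∞)
    (h : ∀ x, ‖f x‖ₑ * a ≤ b * ‖g x‖ₑ) : eLpNorm f p μ * a ≤ b * eLpNorm g p μ := by
  lift a to ℝ≥0 using ha
  lift b to ℝ≥0 using hb
  have e : ∀ c : ℝ≥0, ‖(c : ℝ)‖ₑ = c := fun c => by simp
  rw [← e a, ← e b, mul_comm, ← eLpNorm_const_smul, ← eLpNorm_const_smul]
  refine eLpNorm_mono_enorm fun x => ?_
  rw [Pi.smul_apply, Pi.smul_apply, enorm_smul, enorm_smul, e, e, mul_comm]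
  exact h x

theorem exists_lpNorm_le_supNorm (N : ℕ) (ω : Weight) {p : ℝ≥0} (hp : 1 ≤ p) :
    ∃ k : ℕ, ∀ m : ℕ+, ∃ m' : ℕ+, ∃ C : ℝ≥0∞, C ≠ ∞ ∧ ∀ (n : ℤ) (f : Eu N → ℂ),
      lpNorm ω p m (n + k) f ≤ C * supNorm ω m' n f := by
  obtain ⟨k, hk⟩ := exists_eLpNorm_exp_weight_ne_top N ω hp
  refine ⟨k, fun m => ?_⟩
  obtain ⟨m', C, hC, hle⟩ := exists_derivWeight_le_geometric (N := N) ω m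
  set H := eLpNorm (fun x : Eu N => Real.exp (-(k * ω ‖x‖))) p volume
  set T := ∑' α : Fin N → ℕ, (2⁻¹ : ℝ≥0∞) ^ mlen α
  have hT : T ≠ ∞ := tsum_geometric_mlen_ne_top N
  have hp' : (1 : ℝ) ≤ p := by exact_mod_cast hp
  have hp0 : (0 : ℝ) < p := zero_lt_one.trans_le hp'
  -- The `+ 1` keeps the constant nonzero, so the bound is trivially true when the sup norm is
  -- infinite.
  refine ⟨m', C * H * T ^ (1 / (p : ℝ)) + 1, by finiteness, fun n f => ?_⟩
  set S := supNorm ω m' n f with hSdef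
  by_cases hS : S = ∞
  · rw [hS, ENNReal.mul_top (by simp)]
    exact le_top
  have hterm : ∀ α : Fin N → ℕ,
      eLpNorm (weightedD ω (n + k) α f) p volume * derivWeight ω m α ≤
        C * H * S * 2⁻¹ ^ mlen α := by
    intro α
    have h1 : eLpNorm (weightedD ω (n + k) α f) p volume * derivWeight ω m' α ≤ S * H := by
      refine eLpNorm_mul_le_of_enorm_mul_le (derivWeight_ne_top ω m' α) hS fun x => ?_
      rw [enorm_weightedD_add_left, mul_assoc, mul_comm]
      gcongr
      exact le_iSup₂_of_le (f := fun α x => ‖weightedD ω n α f x‖ₑ * derivWeight ω m' α) α x le_rfl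
    calc _ ≤ eLpNorm (weightedD ω (n + k) α f) p volume *
          (C * 2⁻¹ ^ mlen α * derivWeight ω m' α) := by gcongr; exact hle α
      _ = C * 2⁻¹ ^ mlen α *
          (eLpNorm (weightedD ω (n + k) α f) p volume * derivWeight ω m' α) := by ring
      _ ≤ C * 2⁻¹ ^ mlen α * (S * H) := by gcongr
      _ = _ := by ring
  calc lpNorm ω p m (n + k) f
      ≤ (∑' α : Fin N → ℕ, (C * H * S) ^ (p : ℝ) * 2⁻¹ ^ mlen α) ^ (1 / (p : ℝ)) := by
        unfold lpNorm
        gcongr with α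
        refine (ENNReal.rpow_le_rpow (hterm α) hp0.le).trans ?_
        rw [ENNReal.mul_rpow_of_nonneg _ _ hp0.le]
        gcongr
        -- Since `p ≥ 1`, the `p`-th power of `2^(-|α|)` is at most `2^(-|α|)`, so one geometric
        -- series serves all `p`.
        exact ENNReal.rpow_le_self_of_le_one (pow_le_one₀ (by positivity) (by simp)) hp'
    _ = C * H * S * T ^ (1 / (p : ℝ)) := by
        rw [ENNReal.tsum_mul_left, ENNReal.mul_rpow_of_nonneg _ _ (by positivity), one_div,
          ENNReal.rpow_rpow_inv hp0.ne']
    _ = C * H * T ^ (1 / (p : ℝ)) * S := by ring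
    _ ≤ _ := by gcongr; exact le_self_add

/-! ### Composition of partial derivatives -/

theorem pderiv_comm {N : ℕ} (i j : Fin N) {f : Eu N → ℂ} (hf : ContDiff ℝ (⊤ : ℕ∞) f) :
    pderiv i (pderiv j f) = pderiv j (pderiv i f) := by
  have key : ∀ (i j : Fin N) (x : Eu N), pderiv i (pderiv j f) x =
      fderiv ℝ (fderiv ℝ f) x (EuclideanSpace.single i 1) (EuclideanSpace.single j 1) := by
    intro i j x
    have hd : DifferentiableAt ℝ (fderiv ℝ f) x :=
      ((hf.fderiv_right (m := (⊤ : ℕ∞)) (by simp)).differentiable (by simp)) x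
    unfold pderiv
    rw [fderiv_clm_apply hd (differentiableAt_const _)]
    simp
  funext x
  rw [key, key]
  exact (hf.contDiffAt.isSymmSndFDerivAt (by
    rw [minSmoothness_of_isRCLikeNormedField]
    exact WithTop.coe_le_coe.2 (le_top : (2 : ℕ∞) ≤ ⊤))).eq _ _

theorem pderiv_iter_comm {N : ℕ} (i j : Fin N) (k : ℕ) {f : Eu N → ℂ}
    (hf : ContDiff ℝ (⊤ : ℕ∞) f) : pderiv i ((pderiv j)^[k] f) = (pderiv j)^[k] (pderiv i f) := by
  induction k with
  | zero => rfl
  | succ k ih =>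
    rw [Function.iterate_succ_apply', Function.iterate_succ_apply',
      pderiv_comm i j (contDiff_pderiv_iter j k hf), ih]

theorem pderiv_partialD {N : ℕ} (i : Fin N) (α : Fin N → ℕ) {f : Eu N → ℂ}
    (hf : ContDiff ℝ (⊤ : ℕ∞) f) : pderiv i (partialD α f) = partialD (α + Pi.single i 1) f := by
  have smooth : ∀ (α : Fin N → ℕ) (l : List (Fin N)),
      ContDiff ℝ (⊤ : ℕ∞) (l.foldr (fun i g => (pderiv i)^[α i] g) f) := by
    intro α l
    induction l with
    | nil => exact hf
    | cons i l ih => exact contDiff_pderiv_iter i _ ih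
  -- `∂_i` commutes past the other blocks until it meets its own; `Nodup` ensures that the extra
  -- derivative is counted once.
  have key : ∀ l : List (Fin N), l.Nodup →
      l.foldr (fun j g => (pderiv j)^[(α + Pi.single i 1 : Fin N → ℕ) j] g) f =
        if i ∈ l then pderiv i (l.foldr (fun j g => (pderiv j)^[α j] g) f)
        else l.foldr (fun j g => (pderiv j)^[α j] g) f := by
    intro l hl
    induction l with
    | nil => simp
    | cons j l ih =>
      rw [List.nodup_cons] at hl
      rw [List.foldr_cons, List.foldr_cons, ih hl.2]
      rcases eq_or_ne i j with rfl | hij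
      · simp [hl.1, Function.iterate_succ_apply']
      · have : (α + Pi.single i 1 : Fin N → ℕ) j = α j := by simp [hij.symm]
        rw [this]
        simp only [List.mem_cons, hij, false_or]
        split_ifs
        · rw [pderiv_iter_comm i j _ (smooth α l)]
        · rfl
  rw [partialD, partialD, key _ (List.nodup_finRange N), if_pos (List.mem_finRange i)]

/-! ### A Sobolev inequality on cubes -/

/-- The fundamental theorem of calculus bounds `|g s|` by `|g t| + ∫ |g'|` for each `t` in the
interval; averaging over `t` finishes, the interval having length 1. -/
theorem enorm_le_lintegral_add_deriv {g g' : ℝ → ℂ} (hg : ∀ t, HasDerivAt g (g' t) t)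
    (hg' : Continuous g') {a s : ℝ} (hs : s ∈ Set.Icc a (a + 1)) :
    ‖g s‖ₑ ≤ ∫⁻ t in Set.Icc a (a + 1), (‖g t‖ₑ + ‖g' t‖ₑ) := by
  set D := ∫⁻ t in Set.Icc a (a + 1), ‖g' t‖ₑ
  have hgc : Continuous g := continuous_iff_continuousAt.2 fun t => (hg t).continuousAt
  have h1 : ∀ t ∈ Set.Icc a (a + 1), ‖g s‖ₑ ≤ ‖g t‖ₑ + D := by
    intro t ht
    have hint : ∫ u in t..s, g' u = g s - g t :=
      intervalIntegral.integral_eq_sub_of_hasDerivAt (fun u _ => hg u)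
        (hg'.intervalIntegrable _ _)
    have h2 : ‖g s - g t‖ₑ ≤ D := by
      rw [← hint, enorm_eq_iff_norm_eq.2 (intervalIntegral.norm_intervalIntegral_eq g' t s volume)]
      refine (enorm_integral_le_lintegral_enorm _).trans (lintegral_mono_set ?_)
      exact Set.uIoc_subset_uIcc.trans (Set.uIcc_subset_Icc ht hs)
    calc ‖g s‖ₑ = ‖g t + (g s - g t)‖ₑ := by rw [add_sub_cancel]
      _ ≤ _ := (enorm_add_le _ _).trans (by gcongr)
  have hvol : volume (Set.Icc a (a + 1)) = 1 := by simp
  calc ‖g s‖ₑ = ∫⁻ _ in Set.Icc a (a + 1), ‖g s‖ₑ := by simp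
    _ ≤ ∫⁻ t in Set.Icc a (a + 1), (‖g t‖ₑ + D) := setLIntegral_mono' measurableSet_Icc h1
    _ = _ := by
      rw [lintegral_add_right _ measurable_const, lintegral_add_left hgc.enorm.measurable]
      simp [D]

/-- The cube `∏ i, [a i, a i + 1]`. -/
def unitCube {N : ℕ} (a : Fin N → ℝ) : Set (Eu N) := {y | ∀ i, y i ∈ Set.Icc (a i) (a i + 1)}

theorem hasDerivAt_toLp_update {N : ℕ} {h : Eu N → ℂ} (hh : ContDiff ℝ (⊤ : ℕ∞) h)
    (x : Fin N → ℝ) (i : Fin N) (t : ℝ) :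
    HasDerivAt (fun t => h (WithLp.toLp 2 (Function.update x i t)))
      (pderiv i h (WithLp.toLp 2 (Function.update x i t))) t := by
  have h1 := (PiLp.continuousLinearEquiv 2 ℝ fun _ : Fin N => ℝ).symm.hasFDerivAt.comp_hasDerivAt t
    (hasDerivAt_update x i t)
  have h2 := (hh.differentiable (by simp)
    (WithLp.toLp 2 (Function.update x i t))).hasFDerivAt.comp_hasDerivAt t h1
  exact h2

/-- The one-dimensional inequality is applied one variable at a time; `u` records the variables in
which the derivative term was chosen. The induction must vary `α` and `x`, being used at `α` and `α
+ e_i` with the `i`-th coordinate moved. -/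
theorem enorm_partialD_le_lmarginal {N : ℕ} {f : Eu N → ℂ} (hf : ContDiff ℝ (⊤ : ℕ∞) f)
    (a : Fin N → ℝ) (s : Finset (Fin N)) (α : Fin N → ℕ) (x : Fin N → ℝ)
    (hx : ∀ i, x i ∈ Set.Icc (a i) (a i + 1)) :
    ‖partialD α f (WithLp.toLp 2 x)‖ₑ ≤ ∑ u ∈ s.powerset,
      lmarginal (fun i => volume.restrict (Set.Icc (a i) (a i + 1))) s
        (fun y => ‖partialD (α + ∑ i ∈ u, Pi.single i 1) f (WithLp.toLp 2 y)‖ₑ) x := by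
  have meas : ∀ β : Fin N → ℕ, Measurable fun y : Fin N → ℝ =>
      ‖partialD β f (WithLp.toLp 2 y)‖ₑ := fun β =>
    ((contDiff_partialD β hf).continuous.comp (PiLp.continuous_toLp 2 _)).enorm.measurable
  induction s using Finset.induction_on generalizing α x with
  | empty => simp
  | insert i s hi ih =>
    have hupd : ∀ t ∈ Set.Icc (a i) (a i + 1), ∀ j,
        Function.update x i t j ∈ Set.Icc (a j) (a j + 1) := by
      intro t ht j
      rcases eq_or_ne j i with rfl | hj
      · simpa using ht
      · simpa [hj] using hx j
    have hd := fun t => hasDerivAt_toLp_update (contDiff_partialD α hf) x i t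
    simp only [pderiv_partialD i α hf] at hd
    have hcont : Continuous fun t =>
        partialD (α + Pi.single i 1) f (WithLp.toLp 2 (Function.update x i t)) :=
      (contDiff_partialD _ hf).continuous.comp
        ((PiLp.continuous_toLp 2 _).comp (continuous_const.update i continuous_id))
    have h1 := enorm_le_lintegral_add_deriv hd hcont (hx i)
    simp only [Function.update_eq_self] at h1
    rw [Finset.sum_powerset_insert hi, ← Finset.sum_add_distrib]
    refine h1.trans ?_
    refine (setLIntegral_mono' measurableSet_Icc fun t ht =>
      add_le_add (ih α _ (hupd t ht)) (ih (α + Pi.single i 1) _ (hupd t ht))).trans_eq ?_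
    have hmm : ∀ β : Fin N → ℕ, Measurable fun t : ℝ =>
        lmarginal (fun i => volume.restrict (Set.Icc (a i) (a i + 1))) s
        (fun y => ‖partialD β f (WithLp.toLp 2 y)‖ₑ) (Function.update x i t) := fun β =>
      ((meas β).lmarginal _).comp (measurable_update x)
    simp_rw [← Finset.sum_add_distrib]
    rw [lintegral_finsetSum _ (by exact fun u _ => (hmm _).add (hmm _))]
    refine Finset.sum_congr rfl fun u hu => ?_
    rw [lintegral_add_left (hmm _), lmarginal_insert _ (meas _) hi, lmarginal_insert _ (meas _) hi,
      Finset.sum_insert fun h => hi (Finset.mem_powerset.1 hu h), add_assoc]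

theorem measurableSet_unitCube {N : ℕ} (a : Fin N → ℝ) : MeasurableSet (unitCube a) := by
  have : unitCube a = ⋂ i, (fun y : Eu N => y i) ⁻¹' Set.Icc (a i) (a i + 1) := by
    ext y; simp [unitCube]
  rw [this]
  exact MeasurableSet.iInter fun i => measurableSet_Icc.preimage (by fun_prop)

theorem lintegral_pi_Icc_eq {N : ℕ} (a : Fin N → ℝ) (F : Eu N → ℝ≥0∞) :
    ∫⁻ y, F (WithLp.toLp 2 y) ∂Measure.pi (fun i => volume.restrict (Set.Icc (a i) (a i + 1))) =
      ∫⁻ y in unitCube a, F y := by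
  rw [← Measure.restrict_pi_pi]
  have h := (PiLp.volume_preserving_toLp (Fin N)).setLIntegral_comp_preimage_emb
    (MeasurableEquiv.toLp 2 (Fin N → ℝ)).measurableEmbedding F (unitCube a)
  rw [← h, volume_pi]
  congr 2
  ext y
  simp [unitCube, -Set.pi_univ_Icc]

theorem volume_unitCube {N : ℕ} (a : Fin N → ℝ) : volume (unitCube a) = 1 := by
  have h := lintegral_pi_Icc_eq a fun _ => 1
  simp only [lintegral_const, one_mul, Measure.restrict_apply_univ] at h
  rw [← h, Measure.pi_univ]
  simp

theorem enorm_partialD_le_sum_lintegral {N : ℕ} {f : Eu N → ℂ} (hf : ContDiff ℝ (⊤ : ℕ∞) f)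
    (α : Fin N → ℕ) (x : Eu N) :
    ‖partialD α f x‖ₑ ≤ ∑ u : Finset (Fin N),
      ∫⁻ y in unitCube x, ‖partialD (α + ∑ i ∈ u, Pi.single i 1) f y‖ₑ := by
  refine (enorm_partialD_le_lmarginal hf x.ofLp Finset.univ α x.ofLp fun i => by simp).trans_eq ?_
  rw [Finset.powerset_univ]
  refine Finset.sum_congr rfl fun u _ => ?_
  rw [lmarginal_univ]
  rw [← lintegral_pi_Icc_eq x.ofLp fun y => ‖partialD (α + ∑ i ∈ u, Pi.single i 1) f y‖ₑ]

theorem norm_le_of_mem_unitCube {N : ℕ} {x y : Eu N} (hy : y ∈ unitCube x) :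
    ‖y‖ ≤ ‖x‖ + Real.sqrt N := by
  have h1 : ‖y - x‖ ≤ Real.sqrt N := by
    rw [EuclideanSpace.norm_eq]
    refine Real.sqrt_le_sqrt ?_
    calc ∑ i, ‖(y - x) i‖ ^ 2 ≤ ∑ _i : Fin N, (1 : ℝ) := by
          refine Finset.sum_le_sum fun i _ => ?_
          have h2 := hy i
          rw [PiLp.sub_apply, Real.norm_of_nonneg (sub_nonneg.2 h2.1)]
          exact pow_le_one₀ (sub_nonneg.2 h2.1) (by linarith [h2.2])
      _ = N := by simp
  calc ‖y‖ = ‖x + (y - x)‖ := by rw [add_sub_cancel]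
    _ ≤ _ := (norm_add_le _ _).trans (by gcongr)

/-! ### Estimate of the supremum norms by the `L^p` norms -/

/-- On the cube `|y| ≤ |x| + √N ≤ 2 max(|x|, √N)`, so monotonicity and a single use of (α) suffice.
-/
theorem exists_weight_le_of_mem_unitCube (N : ℕ) (ω : Weight) :
    ∃ K : ℕ, ∃ c : ℝ, ∀ x y : Eu N, y ∈ unitCube x → ω ‖y‖ ≤ K * ω ‖x‖ + c := by
  obtain ⟨K, hK, hdbl⟩ := ω.doubling'
  obtain ⟨k, hk⟩ := exists_nat_ge K
  set R := Real.sqrt N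
  have hR : 0 ≤ R := Real.sqrt_nonneg _
  refine ⟨k, K * (1 + ω R), fun x y hy => ?_⟩
  have hx := norm_nonneg x
  have h0 := ω.nonneg' _ hx
  have h0' := ω.nonneg' _ hR
  have hmax : ω (max ‖x‖ R) ≤ ω ‖x‖ + ω R := by
    rcases le_total ‖x‖ R with h | h
    · rw [max_eq_right h]; linarith
    · rw [max_eq_left h]; linarith
  have hM : 0 ≤ max ‖x‖ R := le_max_of_le_left hx
  calc ω ‖y‖ ≤ ω (2 * max ‖x‖ R) := by
        refine ω.monotoneOn' (norm_nonneg y) (Set.mem_Ici.2 (by positivity)) ?_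
        linarith [norm_le_of_mem_unitCube hy, le_max_left ‖x‖ R, le_max_right ‖x‖ R]
    _ ≤ K * (1 + ω (max ‖x‖ R)) := hdbl _ hM
    _ ≤ K * (1 + (ω ‖x‖ + ω R)) := by gcongr
    _ ≤ _ := by nlinarith

theorem enorm_weightedD {N : ℕ} (ω : Weight) (n : ℤ) (α : Fin N → ℕ) (f : Eu N → ℂ) (x : Eu N) :
    ‖weightedD ω n α f x‖ₑ =
      ENNReal.ofReal (Real.exp (-(n * ω ‖x‖))) * ‖partialD α f x‖ₑ := by
  rw [weightedD, enorm_mul, enorm_eq_iff_norm_eq.2 (Complex.norm_real _),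
    Real.enorm_of_nonneg (Real.exp_nonneg _)]

/-- On a set of measure 1 the `L^1` norm is at most the `L^p` norm, with no constant. -/
theorem setLIntegral_enorm_le_eLpNorm {X E : Type*} [MeasurableSpace X] {μ : Measure X}
    [NormedAddCommGroup E] {p : ℝ≥0∞} (hp : 1 ≤ p) {f : X → E} (hf : AEStronglyMeasurable f μ)
    {s : Set X} (hs : μ s = 1) : ∫⁻ x in s, ‖f x‖ₑ ∂μ ≤ eLpNorm f p μ := by
  have : IsProbabilityMeasure (μ.restrict s) := ⟨by rw [Measure.restrict_apply_univ, hs]⟩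
  rw [← eLpNorm_one_eq_lintegral_enorm]
  exact (eLpNorm_le_eLpNorm_of_exponent_le hp hf.restrict).trans
    (eLpNorm_mono_measure f Measure.restrict_le_self)

theorem eLpNorm_mul_derivWeight_le_lpNorm {N : ℕ} (ω : Weight) {p : ℝ≥0} (hp : 1 ≤ p) (m : ℕ+)
    (n : ℤ) (α : Fin N → ℕ) (f : Eu N → ℂ) :
    eLpNorm (weightedD ω n α f) p volume * derivWeight ω m α ≤ lpNorm ω p m n f := by
  have hp0 : (0 : ℝ) < p := by exact_mod_cast zero_lt_one.trans_le hp
  rw [lpNorm, one_div, ENNReal.le_rpow_inv_iff hp0]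
  exact ENNReal.le_tsum (f := fun α : Fin N → ℕ =>
    (eLpNorm (weightedD ω n α f) p volume * derivWeight ω m α) ^ (p : ℝ)) α

/-- The factor `K` on `n` is the price of moving the weight from `x` to a nearby `y`: `exp (-K n
ω(x)) ≤ exp (n c) exp (-n ω(y))`. Only the constant `C` depends on both `m` and `n`. -/
theorem exists_supNorm_le_lpNorm (N : ℕ) (ω : Weight) {p : ℝ≥0} (hp : 1 ≤ p) :
    ∃ K : ℕ, ∀ m : ℕ+, ∃ m' : ℕ+, ∀ n : ℕ, ∃ C : ℝ≥0∞, C ≠ ∞ ∧ ∀ f ∈ smoothFun N,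
      supNorm ω m (K * n : ℕ) f ≤ C * lpNorm ω p m' n f := by
  obtain ⟨K, c, hω⟩ := exists_weight_le_of_mem_unitCube N ω
  refine ⟨K, fun m => ?_⟩
  obtain ⟨m', C, hC, hle⟩ := exists_derivWeight_le_add (N := N) ω m N
  refine ⟨m', fun n => ⟨∑ _u : Finset (Fin N), ENNReal.ofReal (Real.exp (n * c)) * C, ?_,
    fun f hf => ?_⟩⟩
  · exact ENNReal.sum_ne_top.2 fun _ _ => ENNReal.mul_ne_top ENNReal.ofReal_ne_top hC
  refine iSup_le fun α => iSup_le fun x => ?_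
  rw [enorm_weightedD, Finset.sum_mul]
  calc ENNReal.ofReal (Real.exp (-(((K * n : ℕ) : ℤ) * ω ‖x‖))) * ‖partialD α f x‖ₑ *
        derivWeight ω m α
      ≤ ENNReal.ofReal (Real.exp (-(((K * n : ℕ) : ℤ) * ω ‖x‖))) * (∑ u : Finset (Fin N),
          ∫⁻ y in unitCube x, ‖partialD (α + ∑ i ∈ u, Pi.single i 1) f y‖ₑ) *
        derivWeight ω m α := by
        gcongr
        exact enorm_partialD_le_sum_lintegral hf α x
    _ ≤ _ := by
      rw [Finset.mul_sum, Finset.sum_mul]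
      refine Finset.sum_le_sum fun u _ => ?_
      set β : Fin N → ℕ := ∑ i ∈ u, Pi.single i 1
      -- `|β|` is the cardinality of `u`, a set of variables.
      have hβ : mlen β ≤ N := by
        simp only [mlen, β, Finset.sum_apply]
        rw [Finset.sum_comm]
        simpa using u.card_le_univ
      have hmeas := (continuous_weightedD ω n (α + β) hf).aestronglyMeasurable (μ := volume)
      have h1 : ENNReal.ofReal (Real.exp (-(((K * n : ℕ) : ℤ) * ω ‖x‖))) *
          ∫⁻ y in unitCube x, ‖partialD (α + β) f y‖ₑ ≤
          ENNReal.ofReal (Real.exp (n * c)) * eLpNorm (weightedD ω n (α + β) f) p volume := by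
        refine le_trans ?_ (mul_le_mul_right (setLIntegral_enorm_le_eLpNorm
          (by exact_mod_cast hp) hmeas (volume_unitCube x)) _)
        rw [← lintegral_const_mul' _ _ ENNReal.ofReal_ne_top,
          ← lintegral_const_mul' _ _ ENNReal.ofReal_ne_top]
        refine setLIntegral_mono' (measurableSet_unitCube x) fun y hy => ?_
        rw [enorm_weightedD, ← mul_assoc, ← ENNReal.ofReal_mul (Real.exp_nonneg _),
          ← Real.exp_add]
        gcongr
        have := mul_le_mul_of_nonneg_left (hω x y hy) (Nat.cast_nonneg (α := ℝ) n)
        push_cast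
        linarith
      calc _ ≤ ENNReal.ofReal (Real.exp (n * c)) * eLpNorm (weightedD ω n (α + β) f) p volume *
            (C * derivWeight ω m' (α + β)) := mul_le_mul' h1 (hle α β hβ)
        _ = ENNReal.ofReal (Real.exp (n * c)) * C *
            (eLpNorm (weightedD ω n (α + β) f) p volume * derivWeight ω m' (α + β)) := by ring
        _ ≤ _ := by
          gcongr
          exact eLpNorm_mul_derivWeight_le_lpNorm ω hp m' n (α + β) f

/-! ### Comparison of the limit spaces -/

/-- A map out of the inductive limit must be given on all steps `n` at once, so `m'` is chosen
before `n`, while `n'` may depend on everything. -/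
theorem projLim_indLim_contIncl {N : ℕ} {A B : ℕ+ → ℕ+ → FunSpace N}
    (h : ∀ m, ∃ m', ∀ n, ∃ n', ContIncl (A m' n) (B m n')) :
    ContIncl (projLim fun m => indLim (A m)) (projLim fun m => indLim (B m)) := by
  refine contIncl_projLim fun m => ?_
  obtain ⟨m', h⟩ := h m
  refine (projLim_contIncl _ m').trans (indLim_contIncl (isLC_indLim _) fun n => ?_)
  obtain ⟨n', h⟩ := h n
  exact h.trans (contIncl_indLim _ n')

/-- Here the roles are exchanged: each `n`-th projective limit must land in a single step, so `n'`
is chosen before `m`. -/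
theorem indLim_projLim_contIncl {N : ℕ} {A B : ℕ+ → ℕ+ → FunSpace N}
    (h : ∀ n, ∃ n', ∀ m, ∃ m', ContIncl (A m' n) (B m n')) :
    ContIncl (indLim fun n => projLim fun m => A m n)
      (indLim fun n => projLim fun m => B m n) := by
  refine indLim_contIncl (isLC_indLim _) fun n => ?_
  obtain ⟨n', h⟩ := h n
  refine ContIncl.trans (contIncl_projLim fun m => ?_)
    (contIncl_indLim (fun n => projLim fun m => B m n) n')
  obtain ⟨m', h⟩ := h m
  exact (projLim_contIncl (fun m => A m n) m').trans h

theorem exists_Omn_contIncl_OmnLp (N : ℕ) (ω : Weight) (p : ℝ≥0) (hp : 1 ≤ p) :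
    ∃ ν : ℕ+ → ℕ+, ∀ m : ℕ+, ∃ m' : ℕ+, ∀ n : ℕ+,
      ContIncl (Omn N ω m' ((n : ℕ) : ℤ)) (OmnLp N ω p hp m ((ν n : ℕ) : ℤ)) := by
  obtain ⟨k, hk⟩ := exists_lpNorm_le_supNorm N ω hp
  refine ⟨fun n => ⟨n + k, by positivity⟩, fun m => ?_⟩
  obtain ⟨m', C, hC, h⟩ := hk m
  exact ⟨m', fun n => normedSpace_contIncl ⟨C, hC, fun f _ => h n f⟩⟩

theorem exists_OmnLp_contIncl_Omn (N : ℕ) (ω : Weight) (p : ℝ≥0) (hp : 1 ≤ p) :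
    ∃ ν : ℕ+ → ℕ+, ∀ m : ℕ+, ∃ m' : ℕ+, ∀ n : ℕ+,
      ContIncl (OmnLp N ω p hp m' ((n : ℕ) : ℤ)) (Omn N ω m ((ν n : ℕ) : ℤ)) := by
  obtain ⟨K, hK⟩ := exists_supNorm_le_lpNorm N ω hp
  -- The `+ 1` makes the index positive without knowing `K > 0`; it is harmless because the norms
  -- decrease in `n`.
  refine ⟨fun n => ⟨K * n + 1, by positivity⟩, fun m => ?_⟩
  obtain ⟨m', h⟩ := hK m
  refine ⟨m', fun n => ?_⟩
  obtain ⟨C, hC, h⟩ := h n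
  exact normedSpace_contIncl ⟨C, hC, fun f hf =>
    (supNorm_anti ω m (by simp) f).trans (h f hf)⟩

end UltraDiff

end

theorem proposition3p9 (N : ℕ) (ω : UltraDiff.Weight) (p : NNReal) (hp : 1 ≤ p) :
    UltraDiff.OM N ω = UltraDiff.OMLp N ω p hp ∧
      UltraDiff.OC N ω = UltraDiff.OCLp N ω p hp := by
  obtain ⟨ν, h⟩ := UltraDiff.exists_Omn_contIncl_OmnLp N ω p hp
  obtain ⟨ν', h'⟩ := UltraDiff.exists_OmnLp_contIncl_Omn N ω p hp
  constructor
  · refine UltraDiff.ContIncl.antisymm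
      (UltraDiff.projLim_indLim_contIncl (fun m => ?_))
      (UltraDiff.projLim_indLim_contIncl (fun m => ?_))
    · obtain ⟨m', hm⟩ := h m
      exact ⟨m', fun n => ⟨ν n, hm n⟩⟩
    · obtain ⟨m', hm⟩ := h' m
      exact ⟨m', fun n => ⟨ν' n, hm n⟩⟩
  · refine UltraDiff.ContIncl.antisymm
      (UltraDiff.indLim_projLim_contIncl (fun n => ⟨ν n, fun m => ?_⟩))
      (UltraDiff.indLim_projLim_contIncl (fun n => ⟨ν' n, fun m => ?_⟩))
    · obtain ⟨m', hm⟩ := h m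
      exact ⟨m', hm n⟩
    · obtain ⟨m', hm⟩ := h' m
      exact ⟨m', hm n⟩
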